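/- Let $n,k,r$ be nonnegative integers with $r\ge 2$, $n\ge 1$ and $k\le n$. For $d\ge 1$ let $$e_d(\mathbf{x}_n^r)=\sum_{1\le i_1<\cdots<i_d\le n}x_{i_1}^r\cdots x_{i_d}^r\in\mathbb{C}[x_1,\dots,x_n],$$ and define the homogeneous ideals $$I_{n,k}=\langle x_1^{kr+1},\dots,x_n^{kr+1},\ e_n(\mathbf{x}_n^r),e_{n-1}(\mathbf{x}_n^r),\dots,e_{n-k+1}(\mathbf{x}_n^r)\rangle,$$ $$J_{n,k}=\langle x_1^{kr},\dots,x_n^{kr},\ e_n(\mathbf{x}_n^r),e_{n-1}(\mathbf{x}_n^r),\dots,e_{n-k+1}(\mathbf{x}_n^r)\rangle$$ and the graded quotients $R_{n,k}=\mathbb{C}[x_1,\dots,x_n]/I_{n,k}$ and $S_{n,k}=\mathbb{C}[x_1,\dots,x_n]/J_{n,k}$. For a graded complex vector space $V=\bigoplus_{d\ge 0}V_d$ with finite-dimensional pieces, let $\mathrm{Hilb}(V;q)=\sum_{d\ge 0}\dim(V_d)\,q^d$. Write $[m]_q=1+q+\cdots+q^{m-1}$ and $[m]!_q=[m]_q[m-1]_q\cdots[1]_q$,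 and define the $q$-Stirling numbers by $\mathrm{Stir}_q(m,j)=[j]_q\,\mathrm{Stir}_q(m-1,j)+\mathrm{Stir}_q(m-1,j-1)$ for $m,j\ge 1$, $\mathrm{Stir}_q(0,j)=\delta_{0,j}$ and $\mathrm{Stir}_q(m,0)=0$ for $m\ge 1$. Let $\mathrm{rev}_q$ be the operator reversing the coefficient sequence of a polynomial in $q$, that is, $\mathrm{rev}_q(f)(q)=q^{\deg f}f(q^{-1})$ for $f\neq 0$ and $\mathrm{rev}_q(0)=0$. Then $$\begin{aligned} \mathrm{Hilb}(R_{n,k};q)&=\sum_{z=0}^{n}\binom{n}{z}q^{krz}\cdot\mathrm{rev}_q\bigl([r]_q^{\,n-z}\cdot[k]!_{q^r}\cdot\mathrm{Stir}_{q^r}(n-z,k)\bigr)\\ &=\sum_{z=0}^{n}\binom{n}{z}q^{krz}\cdot[r]_q^{\,n-z}\cdot[k]!_{q^r}\cdot\mathrm{rev}_q\bigl(\mathrm{Stir}_{q^r}(n-z,k)\bigr),\\ \mathrm{Hilb}(S_{n,k};q)&=\mathrm{rev}_q\bigl([r]_q^{\,n}\cdot[k]!_{q^r}\cdot\mathrm{Stir}_{q^r}(n,k)\bigr)\\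 &=[r]_q^{\,n}\cdot[k]!_{q^r}\cdot\mathrm{rev}_q\bigl(\mathrm{Stir}_{q^r}(n,k)\bigr). \end{aligned}$$ -/

import Mathlib

namespace WreathCoinvariant

/-- The `q`-integer `[m]_q = 1 + q + ⋯ + q^(m-1)`. -/
def qInt {A : Type*} [CommSemiring A] (q : A) (m : ℕ) : A :=
  ∑ i ∈ Finset.range m, q ^ i

/-- The `q`-factorial `[m]!_q = [m]_q [m-1]_q ⋯ [1]_q`. -/
def qFactorial {A : Type*} [CommSemiring A] (q : A) (m : ℕ) : A :=
  ∏ i ∈ Finset.range m, qInt q (i + 1)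

/-- The `q`-Stirling numbers `Stir_q(n,k)`: `Stir_q(0,k) = δ_{0,k}`, `Stir_q(n,0) = 0` for `n ≥ 1`, and
`Stir_q(n,k) = [k]_q Stir_q(n-1,k) + Stir_q(n-1,k-1)` for `n, k ≥ 1`. -/
def qStirling {A : Type*} [CommSemiring A] (q : A) : ℕ → ℕ → A
  | 0, 0 => 1
  | 0, _ + 1 => 0
  | _ + 1, 0 => 0
  | n + 1, k + 1 => qInt q (k + 1) * qStirling q n (k + 1) + qStirling q n k

/-- The polynomial `e_d(x_1^r, …, x_n^r)`, the `d`-th elementary symmetric function in the variable powers. -/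
noncomputable def esymmPow (r n d : ℕ) : MvPolynomial (Fin n) ℂ :=
  ∑ s ∈ Finset.powersetCard d (Finset.univ : Finset (Fin n)), ∏ i ∈ s, MvPolynomial.X i ^ r

/-- The ideal of `ℂ[x_1, …, x_n]` generated by `x_1^m, …, x_n^m` together with
`e_n(x^r), e_{n-1}(x^r), …, e_{n-k+1}(x^r)`. -/
noncomputable def powerIdeal (r n k m : ℕ) : Ideal (MvPolynomial (Fin n) ℂ) :=
  Ideal.span (Set.range (fun i : Fin n => (MvPolynomial.X i : MvPolynomial (Fin n) ℂ) ^ m) ∪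
    esymmPow r n '' Set.Icc (n - k + 1) n)

/-- The ideal `I_{n,k} = ⟨x_1^(kr+1), …, x_n^(kr+1), e_n(x^r), …, e_{n-k+1}(x^r)⟩`. -/
noncomputable def idealI (r n k : ℕ) : Ideal (MvPolynomial (Fin n) ℂ) :=
  powerIdeal r n k (k * r + 1)

/-- The ideal `J_{n,k} = ⟨x_1^(kr), …, x_n^(kr), e_n(x^r), …, e_{n-k+1}(x^r)⟩`. -/
noncomputable def idealJ (r n k : ℕ) : Ideal (MvPolynomial (Fin n) ℂ) :=
  powerIdeal r n k (k * r)

/-- The ring `R_{n,k} = ℂ[x_1, …, x_n] / I_{n,k}`. -/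
abbrev RingR (r n k : ℕ) : Type := MvPolynomial (Fin n) ℂ ⧸ idealI r n k

/-- The ring `S_{n,k} = ℂ[x_1, …, x_n] / J_{n,k}`. -/
abbrev RingS (r n k : ℕ) : Type := MvPolynomial (Fin n) ℂ ⧸ idealJ r n k

/-- The degree `d` part of `ℂ[x_1, …, x_n] / I`: the image of the homogeneous polynomials of degree `d`. -/
noncomputable def gradedPart {n : ℕ} (I : Ideal (MvPolynomial (Fin n) ℂ)) (d : ℕ) :
    Submodule ℂ (MvPolynomial (Fin n) ℂ ⧸ I) :=
  (MvPolynomial.homogeneousSubmodule (Fin n) ℂ d).map (Ideal.Quotient.mkₐ ℂ I).toLinearMap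

/-- The Hilbert series `∑_d dim(V_d) q^d` of a family `(V_d)` of subspaces of a complex vector space. -/
noncomputable def hilbertSeries {V : Type*} [AddCommGroup V] [Module ℂ V] (𝒱 : ℕ → Submodule ℂ V) :
    PowerSeries ℤ :=
  PowerSeries.mk fun d => (Module.finrank ℂ (𝒱 d) : ℤ)

/-- `Hilb(R_{n,k}; q)`. -/
noncomputable def hilbR (r n k : ℕ) : PowerSeries ℤ :=
  hilbertSeries (V := RingR r n k) (gradedPart (idealI r n k))

/-- `Hilb(S_{n,k}; q)`. -/
noncomputable def hilbS (r n k : ℕ) : PowerSeries ℤ :=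
  hilbertSeries (V := RingS r n k) (gradedPart (idealJ r n k))

theorem esymmPow_isHomogeneous (r n d : ℕ) : (esymmPow r n d).IsHomogeneous (d * r) := by
  refine MvPolynomial.IsHomogeneous.sum _ _ _ fun s hs => ?_
  rw [← (Finset.mem_powersetCard.1 hs).2, ← smul_eq_mul, ← Finset.sum_const]
  exact MvPolynomial.IsHomogeneous.prod _ _ _ fun i _ => MvPolynomial.isHomogeneous_X_pow i r

section

attribute [local instance] MvPolynomial.gradedAlgebra

/-- The ideals `I_{n,k}` and `J_{n,k}` are homogeneous, so their quotients are graded by `gradedPart`. -/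
theorem powerIdeal_isHomogeneous (r n k m : ℕ) :
    (powerIdeal r n k m).IsHomogeneous (MvPolynomial.homogeneousSubmodule (Fin n) ℂ) := by
  refine Ideal.homogeneous_span _ _ ?_
  rintro _ (⟨i, rfl⟩ | ⟨d, _, rfl⟩)
  · exact ⟨m, MvPolynomial.isHomogeneous_X_pow i m⟩
  · exact ⟨d * r, esymmPow_isHomogeneous r n d⟩

end

/-- The graded parts of the quotient are finite-dimensional. -/
instance gradedPart_finite {n : ℕ} (I : Ideal (MvPolynomial (Fin n) ℂ)) (d : ℕ) :
    Module.Finite ℂ (gradedPart I d) := by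
  have h : MvPolynomial.homogeneousSubmodule (Fin n) ℂ d ≤
      MvPolynomial.restrictTotalDegree (Fin n) ℂ d := fun p hp =>
    (MvPolynomial.mem_restrictTotalDegree _ _ _).2 (MvPolynomial.IsHomogeneous.totalDegree_le hp)
  have : Module.Finite ℂ (MvPolynomial.homogeneousSubmodule (Fin n) ℂ d) :=
    Submodule.finiteDimensional_of_le h
  unfold gradedPart
  infer_instance

end WreathCoinvariant

/-! ### Hilbert series of quotients: comparison, multiplication by a form, deletion of a variable.
-/

namespace WreathCoinvariant

open MvPolynomial Module

/-! The Hilbert series is bounded above coefficientwise by a polynomial `P`, and the total dimension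
is bounded below by a number of points equal to `P(1)`; together these force equality in every
degree.

Upper bound. For a form `f` of degree `e`, the series of the quotient by `I` is at most that of the
quotient by `I + (f)` plus `q^e` times that of the quotient by any ideal inside `(I : f)`
(`HilbertBound.of_colon`). With `f` a power of the last variable, one variable is removed
(`HilbertBound.expIdeal_filtration`); with `f = e_{n-k}(x^r)`, the number of symmetric generators
grows by one or all exponents drop by `r` (`HilbertBound.expIdeal_esymmPow`). Together they
reproduce the recursion of the reversed `q^r`-Stirling numbers, which settles `S`. Raising the
exponents from `kr` to `kr+1` one variable at a time gives the binomial sum for `R`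
(`hilbertBound_raised`).

Lower bound. Take the points whose coordinates are `r`-th roots of `k` fixed distinct nonzero
numbers `α_j`, or also `0` in the case of `R`, such that every `α_j` occurs among the `r`-th powers
of the coordinates. Each generator of the ideal is the leading form of a polynomial vanishing on
these points, so the quotient has dimension at least their number (`finrank_evalFiltration_le`).
Counting words that hit all classes gives `P(1)` (`eval_one_hilbPoly`,
`sum_choose_eval_one_hilbPoly`).

Finally, `q`-integers and `q`-factorials are palindromic, so only the Stirling factor changes under
reversal. -/

instance homogeneousSubmodule_finite (n d : ℕ) :
    Module.Finite ℂ (homogeneousSubmodule (Fin n) ℂ d) := by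
  have h : homogeneousSubmodule (Fin n) ℂ d ≤ restrictTotalDegree (Fin n) ℂ d := fun p hp =>
    (mem_restrictTotalDegree _ _ _).2 (IsHomogeneous.totalDegree_le hp)
  exact Submodule.finiteDimensional_of_le h

/-- A linear map that kills what another one kills has the smaller image. -/
theorem finrank_map_le_of_forall {A B C : Type*} [AddCommGroup A] [Module ℂ A] [AddCommGroup B]
    [Module ℂ B] [AddCommGroup C] [Module ℂ C] (W : Submodule ℂ A) [Module.Finite ℂ W]
    (g : A →ₗ[ℂ] B) (g' : A →ₗ[ℂ] C) (h : ∀ p ∈ W, g p = 0 → g' p = 0) :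
    finrank ℂ (W.map g') ≤ finrank ℂ (W.map g) := by
  have e1 := LinearMap.finrank_range_add_finrank_ker (g.domRestrict W)
  have e2 := LinearMap.finrank_range_add_finrank_ker (g'.domRestrict W)
  have e3 : LinearMap.ker (g.domRestrict W) ≤ LinearMap.ker (g'.domRestrict W) := by
    intro p hp
    simp only [LinearMap.mem_ker, LinearMap.domRestrict_apply] at hp ⊢
    exact h _ p.2 hp
  have e4 := Submodule.finrank_mono e3
  rw [LinearMap.range_domRestrict] at e1 e2
  lia

theorem finrank_le_map_add_inf_ker {A B : Type*} [AddCommGroup A] [Module ℂ A] [AddCommGroup B]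
    [Module ℂ B] (V : Submodule ℂ A) [Module.Finite ℂ V] (g : A →ₗ[ℂ] B) (M : Submodule ℂ A)
    [Module.Finite ℂ M] (h : ∀ p ∈ V, g p = 0 → p ∈ M) :
    finrank ℂ V ≤ finrank ℂ (V.map g) + finrank ℂ M := by
  have e1 := LinearMap.finrank_range_add_finrank_ker (g.domRestrict V)
  rw [LinearMap.range_domRestrict] at e1
  have e2 : finrank ℂ (LinearMap.ker (g.domRestrict V)) ≤ finrank ℂ M := by
    rw [← Submodule.finrank_map_subtype_eq V]
    refine Submodule.finrank_mono ?_
    rintro _ ⟨p, hp, rfl⟩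
    exact h _ p.2 hp
  lia

section

attribute [local instance] MvPolynomial.gradedAlgebra

theorem homogeneousComponent_add_mul {σ : Type*} {p : MvPolynomial σ ℂ} {e : ℕ}
    (hp : p.IsHomogeneous e) (q : MvPolynomial σ ℂ) (d : ℕ) :
    homogeneousComponent (d + e) (p * q) = p * homogeneousComponent d q := by
  have h := DirectSum.coe_decompose_mul_add_of_left_mem (homogeneousSubmodule σ ℂ) (i := e)
    (j := d) (a := p) (b := q) hp
  rw [add_comm d e]
  simp only [← decomposition.decompose'_apply]
  exact h

theorem homogeneousComponent_mul_of_lt {σ : Type*} {p : MvPolynomial σ ℂ} {e : ℕ}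
    (hp : p.IsHomogeneous e) (q : MvPolynomial σ ℂ) {d : ℕ} (hd : d < e) :
    homogeneousComponent d (p * q) = 0 := by
  have h := DirectSum.coe_decompose_mul_of_left_mem_of_not_le (homogeneousSubmodule σ ℂ) (i := e)
    (n := d) (a := p) (b := q) hp (by lia)
  simp only [← decomposition.decompose'_apply]
  exact h

/-- An ideal spanned by homogeneous polynomials contains the homogeneous components of its
elements. -/
theorem homogeneousComponent_mem_span {σ : Type*} {s : Set (MvPolynomial σ ℂ)}
    (hs : ∀ p ∈ s, ∃ e, p.IsHomogeneous e) {p : MvPolynomial σ ℂ} (hp : p ∈ Ideal.span s) (d : ℕ) :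
    homogeneousComponent d p ∈ Ideal.span s :=
  homogeneousComponent_mem_of_mem (Ideal.homogeneous_span _ _ fun p hp => hs p hp) hp d

end

/-- The polynomial `P` bounds the Hilbert series of the quotient by `I` coefficientwise. -/
def HilbertBound {n : ℕ} (I : Ideal (MvPolynomial (Fin n) ℂ)) (P : Polynomial ℤ) : Prop :=
  ∀ d, (finrank ℂ (gradedPart I d) : ℤ) ≤ P.coeff d

theorem finrank_gradedPart_anti {n : ℕ} {I I' : Ideal (MvPolynomial (Fin n) ℂ)} (h : I ≤ I')
    (d : ℕ) : finrank ℂ (gradedPart I' d) ≤ finrank ℂ (gradedPart I d) := by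
  refine finrank_map_le_of_forall _ _ _ fun p _ hp => ?_
  have hp : Ideal.Quotient.mk I p = 0 := hp
  change Ideal.Quotient.mk I' p = 0
  rw [Ideal.Quotient.eq_zero_iff_mem] at hp ⊢
  exact h hp

theorem HilbertBound.anti {n : ℕ} {I I' : Ideal (MvPolynomial (Fin n) ℂ)} {P : Polynomial ℤ}
    (h : HilbertBound I P) (hI : I ≤ I') : HilbertBound I' P := fun d =>
  le_trans (by exact_mod_cast finrank_gradedPart_anti hI d) (h d)

theorem HilbertBound.top {n : ℕ} : HilbertBound (⊤ : Ideal (MvPolynomial (Fin n) ℂ)) 0 := by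
  intro d
  have : gradedPart (⊤ : Ideal (MvPolynomial (Fin n) ℂ)) d = ⊥ := by
    rw [eq_bot_iff]
    rintro _ ⟨p, -, rfl⟩
    change Ideal.Quotient.mk ⊤ p = 0
    rw [Ideal.Quotient.eq_zero_iff_mem]
    trivial
  simp [this]

/-- Take the component of degree `d` in `p = a + f b`: since `I` is homogeneous, `b` may be replaced
by its component of degree `d - e`, which is absent when `d < e`. This describes the kernel of the
map from the quotient by `I` to the quotient by `I + (f)`. -/
theorem mem_gradedPart_of_mem_sup {n : ℕ} {I : Ideal (MvPolynomial (Fin n) ℂ)}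
    (hI : ∀ p ∈ I, ∀ d, homogeneousComponent d p ∈ I) {f : MvPolynomial (Fin n) ℂ} {e : ℕ}
    (hf : f.IsHomogeneous e) {p : MvPolynomial (Fin n) ℂ} {d : ℕ} (hp : p.IsHomogeneous d)
    (hpf : p ∈ I ⊔ Ideal.span {f}) :
    (d < e → p ∈ I) ∧ ∀ c, d = c + e → ∃ q : MvPolynomial (Fin n) ℂ,
      q.IsHomogeneous c ∧ p - f * q ∈ I := by
  obtain ⟨a, ha, b, hb, rfl⟩ := Submodule.mem_sup.1 hpf
  obtain ⟨b, rfl⟩ := Ideal.mem_span_singleton'.1 hb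
  rw [mul_comm b f] at *
  have h := homogeneousComponent_eq_self hp
  refine ⟨fun hd => ?_, ?_⟩
  · rw [map_add, homogeneousComponent_mul_of_lt hf _ hd, add_zero] at h
    exact h ▸ hI _ ha _
  · rintro c rfl
    rw [map_add, homogeneousComponent_add_mul hf] at h
    refine ⟨_, homogeneousComponent_isHomogeneous c b, ?_⟩
    rw [← h, add_sub_cancel_right]
    exact hI _ ha _

/-- The exact sequence of multiplication by `f`: the Hilbert series of the quotient by `I` is at
most that of the quotient by `I + (f)` plus the shifted one of the quotient by any ideal that `f`
multiplies into `I`. -/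
theorem HilbertBound.of_colon {n : ℕ} {I K : Ideal (MvPolynomial (Fin n) ℂ)}
    (hI : ∀ p ∈ I, ∀ d, homogeneousComponent d p ∈ I) {f : MvPolynomial (Fin n) ℂ} {e : ℕ}
    (hf : f.IsHomogeneous e) {P Q : Polynomial ℤ} (hP : HilbertBound (I ⊔ Ideal.span {f}) P)
    (hQ : HilbertBound K Q) (hK : ∀ p ∈ K, f * p ∈ I) :
    HilbertBound I (P + Polynomial.X ^ e * Q) := by
  intro d
  set I' := I ⊔ Ideal.span {f}
  let ψ : (MvPolynomial (Fin n) ℂ ⧸ I) →ₗ[ℂ] (MvPolynomial (Fin n) ℂ ⧸ I') :=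
    (Ideal.Quotient.factorₐ ℂ (le_sup_left : I ≤ I')).toLinearMap
  have hψ : (gradedPart I d).map ψ = gradedPart I' d := by
    rw [gradedPart, gradedPart, ← Submodule.map_comp]
    rfl
  rw [Polynomial.coeff_add, Polynomial.coeff_X_pow_mul']
  have hψ0 : ∀ p : MvPolynomial (Fin n) ℂ, ψ (Ideal.Quotient.mk I p) = 0 → p ∈ I' := by
    intro p hp
    rw [← Ideal.Quotient.eq_zero_iff_mem]
    exact hp
  split_ifs with hd
  · obtain ⟨c, rfl⟩ := Nat.exists_eq_add_of_le' hd
    rw [Nat.add_sub_cancel]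
    -- The kernel of `ψ` in degree `c + e` lies in the image of `μ` on forms of degree `c`, and `μ`
    -- kills the forms in `K`.
    let μ : MvPolynomial (Fin n) ℂ →ₗ[ℂ] (MvPolynomial (Fin n) ℂ ⧸ I) :=
      (Ideal.Quotient.mkₐ ℂ I).toLinearMap ∘ₗ LinearMap.mulLeft ℂ f
    have h1 := finrank_le_map_add_inf_ker (gradedPart I (c + e)) ψ
      ((homogeneousSubmodule (Fin n) ℂ c).map μ) (by
        rintro _ ⟨p, hp, rfl⟩ h
        obtain ⟨q, hq, hpq⟩ := (mem_gradedPart_of_mem_sup hI hf hp (hψ0 p h)).2 c rfl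
        refine ⟨q, hq, ?_⟩
        change Ideal.Quotient.mk I (f * q) = Ideal.Quotient.mk I p
        exact ((Ideal.Quotient.eq).2 hpq).symm)
    have h2 : finrank ℂ ((homogeneousSubmodule (Fin n) ℂ c).map μ) ≤ finrank ℂ (gradedPart K c) := by
      refine finrank_map_le_of_forall _ _ _ fun p _ hp => ?_
      have hp : Ideal.Quotient.mk K p = 0 := hp
      change Ideal.Quotient.mk I (f * p) = 0
      rw [Ideal.Quotient.eq_zero_iff_mem] at hp ⊢
      exact hK p hp
    rw [hψ] at h1
    have h3 := hP (c + e)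
    have h4 := hQ c
    lia
  · have h1 := finrank_le_map_add_inf_ker (gradedPart I d) ψ ⊥ (by
        rintro _ ⟨p, hp, rfl⟩ h
        rw [Submodule.mem_bot]
        change Ideal.Quotient.mk I p = 0
        rw [Ideal.Quotient.eq_zero_iff_mem]
        exact (mem_gradedPart_of_mem_sup hI hf hp (hψ0 p h)).1 (by lia))
    rw [hψ, finrank_bot] at h1
    have h3 := hP d
    lia

/-- Deleting a variable that lies in the ideal. -/
theorem HilbertBound.of_succAbove {n : ℕ} {K : Ideal (MvPolynomial (Fin (n + 1)) ℂ)}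
    {K' : Ideal (MvPolynomial (Fin n) ℂ)} (i : Fin (n + 1)) (hi : X i ∈ K)
    (hK : K' ≤ K.comap (rename i.succAbove : _ →ₐ[ℂ] MvPolynomial (Fin (n + 1)) ℂ))
    {P : Polynomial ℤ} (hP : HilbertBound K' P) : HilbertBound K P := by
  intro d
  refine le_trans ?_ (hP d)
  norm_cast
  let g : MvPolynomial (Fin n) ℂ →ₗ[ℂ] (MvPolynomial (Fin (n + 1)) ℂ ⧸ K) :=
    (Ideal.Quotient.mkₐ ℂ K).toLinearMap ∘ₗ (rename i.succAbove).toLinearMap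
  have h1 : gradedPart K d ≤ (homogeneousSubmodule (Fin n) ℂ d).map g := by
    rintro _ ⟨p, hp, rfl⟩
    -- Setting `x_i = 0` preserves degrees and changes nothing modulo `K`.
    let v : Fin (n + 1) → MvPolynomial (Fin n) ℂ := i.insertNth 0 X
    refine ⟨aeval v p, ?_, ?_⟩
    · have := IsHomogeneous.aeval (n := 1) hp v fun j => ?_
      · rwa [one_mul] at this
      · refine Fin.succAboveCases i ?_ (fun l => ?_) j
        · simpa [v] using isHomogeneous_zero (Fin n) ℂ 1
        · simpa [v] using isHomogeneous_X ℂ l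
    · have : ((Ideal.Quotient.mkₐ ℂ K).comp (rename i.succAbove)).comp (aeval v) =
          Ideal.Quotient.mkₐ ℂ K := by
        refine algHom_ext fun j => Fin.succAboveCases i ?_ (fun l => ?_) j
        · simpa [v] using ((Ideal.Quotient.eq_zero_iff_mem).2 hi).symm
        · simp [v]
      exact congrArg (fun f => f p) this
  refine (Submodule.finrank_mono h1).trans (finrank_map_le_of_forall _ _ _ fun p _ hp => ?_)
  have hp : Ideal.Quotient.mk K' p = 0 := hp
  change Ideal.Quotient.mk K (rename i.succAbove p) = 0
  rw [Ideal.Quotient.eq_zero_iff_mem] at hp ⊢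
  exact hK hp

end WreathCoinvariant

/-! ### Upper bounds for the ideals generated by variable powers and symmetric functions. -/

namespace WreathCoinvariant

open MvPolynomial Module

theorem esymmPow_zero (r n : ℕ) : esymmPow r n 0 = 1 := by
  simp [esymmPow]

theorem esymmPow_eq_zero_of_lt {r n d : ℕ} (h : n < d) : esymmPow r n d = 0 := by
  rw [esymmPow, Finset.powersetCard_eq_empty.2 (by simpa using h), Finset.sum_empty]

/-- The subsets of size `d + 1` are sorted by whether they contain `i`. -/
theorem esymmPow_succ (r n d : ℕ) (i : Fin (n + 1)) :
    esymmPow r (n + 1) (d + 1) = rename i.succAbove (esymmPow r n (d + 1)) +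
      X i ^ r * rename i.succAbove (esymmPow r n d) := by
  classical
  have hi : i ∉ (Finset.univ : Finset (Fin n)).map i.succAboveEmb := by simp
  have hu : (Finset.univ : Finset (Fin (n + 1))) =
      insert i ((Finset.univ : Finset (Fin n)).map i.succAboveEmb) := by
    rw [Fin.univ_succAbove n i, Finset.cons_eq_insert]
  have hs : ∀ d, rename i.succAbove (esymmPow r n d) =
      ∑ s ∈ ((Finset.univ : Finset (Fin n)).map i.succAboveEmb).powersetCard d,
        ∏ j ∈ s, (X j : MvPolynomial (Fin (n + 1)) ℂ) ^ r := by
    intro d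
    rw [Finset.powersetCard_map, Finset.sum_map, esymmPow, map_sum]
    refine Finset.sum_congr rfl fun s _ => ?_
    rw [map_prod]
    refine Eq.trans ?_ (Finset.prod_map s i.succAboveEmb _).symm
    simp
  rw [hs, hs, esymmPow, hu, Finset.powersetCard_succ_insert hi, Finset.sum_union, Finset.sum_image,
    Finset.mul_sum]
  · congr 1
    refine Finset.sum_congr rfl fun s h => ?_
    rw [Finset.prod_insert]
    exact fun h' => hi ((Finset.mem_powersetCard.1 h).1 h')
  · intro s h t h' e
    have hs : i ∉ s := fun h1 => hi ((Finset.mem_powersetCard.1 h).1 h1)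
    have ht : i ∉ t := fun h1 => hi ((Finset.mem_powersetCard.1 h').1 h1)
    rw [← Finset.erase_insert hs, ← Finset.erase_insert ht, e]
  · rw [Finset.disjoint_left]
    intro s h h'
    obtain ⟨t, -, rfl⟩ := Finset.mem_image.1 h'
    exact hi ((Finset.mem_powersetCard.1 h).1 (Finset.mem_insert_self _ _))

/-- The ideal spanned by the powers `x_i ^ m_i` and by the `e_d(x^r)` with `n < d + s`. -/
noncomputable def expIdeal (r n : ℕ) (m : Fin n → ℕ) (s : ℕ) : Ideal (MvPolynomial (Fin n) ℂ) :=
  Ideal.span (Set.range (fun i : Fin n => (X i : MvPolynomial (Fin n) ℂ) ^ m i) ∪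
    esymmPow r n '' {d | n < d + s})

theorem X_pow_mem_expIdeal {r n s : ℕ} {m : Fin n → ℕ} (i : Fin n) {l : ℕ} (hl : m i ≤ l) :
    X i ^ l ∈ expIdeal r n m s :=
  Ideal.mem_of_dvd _ (pow_dvd_pow _ hl) (Ideal.subset_span (Or.inl ⟨i, rfl⟩))

theorem esymmPow_mem_expIdeal {r n s d : ℕ} {m : Fin n → ℕ} (h : n < d + s) :
    esymmPow r n d ∈ expIdeal r n m s :=
  Ideal.subset_span (Or.inr ⟨d, h, rfl⟩)

theorem expIdeal_le {r n s : ℕ} {m : Fin n → ℕ} {I : Ideal (MvPolynomial (Fin n) ℂ)}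
    (h1 : ∀ i, X i ^ m i ∈ I) (h2 : ∀ d, n < d + s → esymmPow r n d ∈ I) :
    expIdeal r n m s ≤ I := by
  refine Ideal.span_le.2 ?_
  rintro _ (⟨i, rfl⟩ | ⟨d, hd, rfl⟩)
  · exact h1 i
  · exact h2 d hd

theorem powerIdeal_eq_expIdeal {r n k m : ℕ} (hk : k ≤ n) :
    powerIdeal r n k m = expIdeal r n (fun _ => m) k := by
  apply le_antisymm
  · refine Ideal.span_le.2 ?_
    rintro _ (⟨i, rfl⟩ | ⟨d, hd, rfl⟩)
    · exact X_pow_mem_expIdeal i le_rfl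
    · have := hd.1
      exact esymmPow_mem_expIdeal (by lia)
  · refine expIdeal_le (fun i => Ideal.subset_span (Or.inl ⟨i, rfl⟩)) fun d hd => ?_
    by_cases h : d ≤ n
    · exact Ideal.subset_span (Or.inr ⟨d, ⟨by lia, h⟩, rfl⟩)
    · rw [esymmPow_eq_zero_of_lt (by lia)]
      exact zero_mem _

theorem homogeneousComponent_mem_expIdeal {r n s : ℕ} {m : Fin n → ℕ}
    (p : MvPolynomial (Fin n) ℂ) (hp : p ∈ expIdeal r n m s) (d : ℕ) :
    homogeneousComponent d p ∈ expIdeal r n m s := by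
  refine homogeneousComponent_mem_span ?_ hp d
  rintro _ (⟨i, rfl⟩ | ⟨d, -, rfl⟩)
  · exact ⟨_, isHomogeneous_X_pow i _⟩
  · exact ⟨_, esymmPow_isHomogeneous r n d⟩

theorem homogeneousComponent_mem_sup_span {σ : Type*} {I : Ideal (MvPolynomial σ ℂ)}
    (hI : ∀ p ∈ I, ∀ d, homogeneousComponent d p ∈ I) {f : MvPolynomial σ ℂ} {e : ℕ}
    (hf : f.IsHomogeneous e) (p : MvPolynomial σ ℂ) (hp : p ∈ I ⊔ Ideal.span {f}) (d : ℕ) :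
    homogeneousComponent d p ∈ I ⊔ Ideal.span {f} := by
  obtain ⟨a, ha, b, hb, rfl⟩ := Submodule.mem_sup.1 hp
  rw [map_add]
  refine Submodule.add_mem_sup (hI a ha d) (homogeneousComponent_mem_span ?_ hb d)
  rintro _ rfl
  exact ⟨e, hf⟩

/-- For `s > n` the condition `n < d + s` admits `d = 0`, and `e_0 = 1`. Hence the recursion may run
through `k > n`, where all series vanish. -/
theorem expIdeal_eq_top {r n s : ℕ} {m : Fin n → ℕ} (h : n < s) :
    expIdeal r n m s = ⊤ := by
  rw [Ideal.eq_top_iff_one, ← esymmPow_zero r n]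
  exact esymmPow_mem_expIdeal (by lia)

/-- The ideal of all polynomials that `f` multiplies into `I`. -/
noncomputable def colonIdeal {n : ℕ} (f : MvPolynomial (Fin n) ℂ)
    (I : Ideal (MvPolynomial (Fin n) ℂ)) : Ideal (MvPolynomial (Fin n) ℂ) :=
  Submodule.comap (LinearMap.mulLeft _ f) I

theorem mem_colonIdeal {n : ℕ} {f p : MvPolynomial (Fin n) ℂ}
    {I : Ideal (MvPolynomial (Fin n) ℂ)} : p ∈ colonIdeal f I ↔ f * p ∈ I := Iff.rfl

/-- Write `e'` for the symmetric functions without `x_i`. Multiplying `e_{d+1} = e'_{d+1} + x_i^r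
e'_d` by `x_i^{jr}` trades a lower index of `e'` for one more factor `x_i^r`; the descent starts
from `e'_d = 0` for `d > n`. -/
theorem X_pow_mul_rename_esymmPow_mem {r n s : ℕ} {I : Ideal (MvPolynomial (Fin (n + 1)) ℂ)}
    (hI : ∀ d, n + 1 < d + s → esymmPow r (n + 1) d ∈ I) (i : Fin (n + 1)) {j d : ℕ} (hj : j ≤ s)
    (hd : n < d + j) : X i ^ (j * r) * rename i.succAbove (esymmPow r n d) ∈ I := by
  induction j generalizing d with
  | zero => simp [esymmPow_eq_zero_of_lt (show n < d by lia)]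
  | succ j ih =>
    have h1 := hI (d + 1) (by lia)
    rw [esymmPow_succ r n d i] at h1
    have h2 := ih (d := d + 1) (by lia) (by lia)
    have h3 := sub_mem (I.mul_mem_left (X i ^ (j * r)) h1) h2
    convert h3 using 1
    ring

/-- The recursion satisfied by the reversed `q^r`-Stirling numbers. -/
noncomputable def revStirling (r : ℕ) : ℕ → ℕ → Polynomial ℤ
  | 0, 0 => 1
  | 0, _ + 1 => 0
  | _ + 1, 0 => 0
  | n + 1, k + 1 => qInt (Polynomial.X ^ r) (k + 1) * revStirling r n (k + 1) +
      Polynomial.X ^ (r * (n - k)) * revStirling r n k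

/-- The Hilbert series of the ring `S_{n,k}`. -/
noncomputable def hilbPoly (r n k : ℕ) : Polynomial ℤ :=
  qInt Polynomial.X r ^ n * qFactorial (Polynomial.X ^ r) k * revStirling r n k

theorem qInt_mul {A : Type*} [CommSemiring A] (q : A) (a r : ℕ) :
    qInt q (a * r) = qInt q r * qInt (q ^ r) a := by
  induction a with
  | zero => simp [qInt]
  | succ a ih =>
    have h : qInt q (a * r + r) = qInt q (a * r) + q ^ (a * r) * qInt q r := by
      simp only [qInt, Finset.sum_range_add, Finset.mul_sum, pow_add]
    rw [add_mul, one_mul, h, ih, qInt, qInt, qInt, Finset.sum_range_succ]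
    ring

/-- The factorization `[(k+1)r]_q = [r]_q [k+1]_{q^r}` puts the Stirling recursion in the shape of
the two bounds: the outer factor counts powers of the last variable, the bracket comes from
multiplication by `e_{n-k}`. -/
theorem hilbPoly_succ (r n k : ℕ) :
    hilbPoly r (n + 1) (k + 1) = qInt Polynomial.X ((k + 1) * r) *
      (hilbPoly r n (k + 1) + Polynomial.X ^ (r * (n - k)) * hilbPoly r n k) := by
  rw [qInt_mul, hilbPoly, hilbPoly, hilbPoly, revStirling]
  rw [qFactorial, Finset.prod_range_succ, ← qFactorial]
  ring

/-- Filter by the powers `x^j` of the last variable, `j < (k+1)r`. On the layer of `x^j` the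
variable `x` acts as zero, so each `e_d` acts as its analogue in the other `n` variables, and every
layer is bounded by `Q`. -/
theorem HilbertBound.expIdeal_filtration {r n k : ℕ} (hr : 0 < r) {Q : Polynomial ℤ}
    (hQ : HilbertBound (expIdeal r n (fun _ => (k + 1) * r) k) Q) :
    HilbertBound (expIdeal r (n + 1) (fun _ => (k + 1) * r) (k + 1))
      (qInt Polynomial.X ((k + 1) * r) * Q) := by
  set I := expIdeal r (n + 1) (fun _ => (k + 1) * r) (k + 1) with hI
  have key : ∀ j, HilbertBound (I ⊔ Ideal.span {X (Fin.last n) ^ j})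
      (qInt Polynomial.X j * Q) := by
    intro j
    induction j with
    | zero =>
      have : I ⊔ Ideal.span {X (Fin.last n) ^ 0} = ⊤ := by simp
      rw [this]
      simpa [qInt] using HilbertBound.top
    | succ j ih =>
      rw [qInt, Finset.sum_range_succ, add_mul, ← qInt]
      set L := I ⊔ Ideal.span {X (Fin.last n) ^ (j + 1)} with hL
      have hX : X (Fin.last n) ^ (j + 1) ∈ L :=
        Ideal.mem_sup_right (Ideal.mem_span_singleton_self _)
      refine HilbertBound.of_colon (K := colonIdeal (X (Fin.last n) ^ j) L)
        (homogeneousComponent_mem_sup_span homogeneousComponent_mem_expIdeal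
          (isHomogeneous_X_pow _ _)) (isHomogeneous_X_pow (Fin.last n) j) (ih.anti ?_) ?_
        fun p hp => hp
      · exact sup_le_sup_right le_sup_left _
      · refine hQ.of_succAbove (Fin.last n) ?_ (expIdeal_le (fun i => ?_) fun d hd => ?_)
        · rwa [mem_colonIdeal, ← pow_succ]
        · rw [Ideal.mem_comap, mem_colonIdeal, map_pow, rename_X]
          exact Ideal.mul_mem_left _ _ (Ideal.mem_sup_left (X_pow_mem_expIdeal _ le_rfl))
        · rw [Ideal.mem_comap, mem_colonIdeal]
          have h1 : esymmPow r (n + 1) d ∈ L :=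
            Ideal.mem_sup_left (esymmPow_mem_expIdeal (by lia))
          cases d with
          | zero =>
            rw [esymmPow_zero] at h1 ⊢
            rw [map_one]
            exact Ideal.mul_mem_left _ _ h1
          | succ d =>
            rw [esymmPow_succ r n d (Fin.last n)] at h1
            -- Positivity of `r` makes the second summand of `x^j e_{d+1}` divisible by `x^{j+1}`.
            have h2 : X (Fin.last n) ^ (j + r) ∈ L := Ideal.mem_of_dvd _ (pow_dvd_pow _ (by lia)) hX
            have h3 := sub_mem (L.mul_mem_left (X (Fin.last n) ^ j) h1)
              (L.mul_mem_right (rename (Fin.last n).succAbove (esymmPow r n d)) h2)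
            convert h3 using 1
            ring
  -- At `j = (k+1)r` the added power already lies in `I`.
  refine (key _).anti (sup_le le_rfl ?_)
  rw [Ideal.span_singleton_le_iff_mem]
  exact X_pow_mem_expIdeal _ le_rfl

/-- Here `f = e_{n-k}(x^r)`, of degree `r(n-k)`. Adding `f` supplies the next symmetric generator;
the essential point for the colon ideal is `x_i^{kr} f ∈ I`. -/
theorem HilbertBound.expIdeal_esymmPow {r n k : ℕ} {P Q : Polynomial ℤ}
    (hP : HilbertBound (expIdeal r n (fun _ => (k + 1) * r) (k + 1)) P)
    (hQ : HilbertBound (expIdeal r n (fun _ => k * r) k) Q) :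
    HilbertBound (expIdeal r n (fun _ => (k + 1) * r) k)
      (P + Polynomial.X ^ (r * (n - k)) * Q) := by
  rw [mul_comm r]
  set I := expIdeal r n (fun _ => (k + 1) * r) k with hI
  by_cases hk : k ≤ n
  swap
  · rw [expIdeal_eq_top (by lia)] at hP hQ
    have : I = ⊤ := expIdeal_eq_top (by lia)
    rw [show n - k = 0 by lia, zero_mul, this]
    -- For `k > n` all quotients are zero and truncated subtraction makes the shift `0`, so the
    -- sequence for `f = 1` suffices.
    refine HilbertBound.of_colon (K := ⊤) (f := 1) (fun _ _ _ => Submodule.mem_top) (isHomogeneous_one _ _)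
      (hP.anti ?_) hQ fun _ _ => Submodule.mem_top
    exact le_sup_left
  refine HilbertBound.of_colon (K := colonIdeal (esymmPow r n (n - k)) I)
    homogeneousComponent_mem_expIdeal (esymmPow_isHomogeneous r n (n - k))
    (hP.anti (expIdeal_le (fun i => ?_) fun d hd => ?_))
    (hQ.anti (expIdeal_le (fun i => ?_) fun d hd => ?_)) fun p hp => hp
  · exact Ideal.mem_sup_left (X_pow_mem_expIdeal _ le_rfl)
  · by_cases h : n < d + k
    · exact Ideal.mem_sup_left (esymmPow_mem_expIdeal h)
    · rw [show d = n - k by lia]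
      exact Ideal.mem_sup_right (Ideal.mem_span_singleton_self _)
  · rw [mem_colonIdeal]
    cases n with
    | zero => exact i.elim0
    | succ n =>
      have hE : ∀ d, n + 1 < d + k → esymmPow r (n + 1) d ∈ I := fun d => esymmPow_mem_expIdeal
      rw [mul_comm]
      rcases h : n + 1 - k with _ | c
      · have := X_pow_mul_rename_esymmPow_mem hE i (j := k) (d := 0) le_rfl (by lia)
        rwa [esymmPow_zero, map_one, ← esymmPow_zero r (n + 1)] at this
      -- In `x_i^{kr} (e'_{c+1} + x_i^r e'_c)` the first term lies in `I` by the descent, the second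
      -- because it contains `x_i^{(k+1)r}`.
      · have h1 := X_pow_mul_rename_esymmPow_mem hE i (j := k) (d := c + 1) le_rfl (by lia)
        have h2 : X i ^ ((k + 1) * r) ∈ I := X_pow_mem_expIdeal _ le_rfl
        have h3 := add_mem h1 (I.mul_mem_right (rename i.succAbove (esymmPow r n c)) h2)
        rw [esymmPow_succ r n c i]
        convert h3 using 1
        ring
  · exact Ideal.mul_mem_left _ _ (esymmPow_mem_expIdeal hd)

theorem hilbertBound_const {r : ℕ} (hr : 0 < r) (n k : ℕ) :
    HilbertBound (expIdeal r n (fun _ => k * r) k) (hilbPoly r n k) := by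
  induction n generalizing k with
  | zero =>
    cases k with
    | zero =>
      have h0 : hilbPoly r 0 0 = 1 := by simp [hilbPoly, revStirling, qFactorial]
      rw [h0]
      intro d
      rw [Polynomial.coeff_one]
      have h1 : finrank ℂ (gradedPart (expIdeal r 0 (fun _ => 0 * r) 0) d) ≤
          finrank ℂ (homogeneousSubmodule (Fin 0) ℂ d) := Submodule.finrank_map_le _ _
      split_ifs with hd
      · subst hd
        have h2 : homogeneousSubmodule (Fin 0) ℂ 0 ≤ Submodule.span ℂ {1} := by
          intro p _
          rw [Submodule.mem_span_singleton, eq_C_of_isEmpty p]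
          exact ⟨_, by rw [smul_eq_C_mul, mul_one]⟩
        have h3 := Submodule.finrank_mono h2
        have h4 := finrank_span_le_card (R := ℂ) ({1} : Set (MvPolynomial (Fin 0) ℂ))
        simp only [Set.toFinset_singleton, Finset.card_singleton] at h4
        exact_mod_cast h1.trans (h3.trans h4)
      · have h2 : homogeneousSubmodule (Fin 0) ℂ d = ⊥ := by
          rw [eq_bot_iff]
          intro p hp
          rw [Submodule.mem_bot]
          by_contra h
          have hp : p.IsHomogeneous d := hp
          rw [eq_C_of_isEmpty p] at hp h
          exact hd ((hp.inj_right (isHomogeneous_C _ _) h))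
        rw [h2, finrank_bot] at h1
        exact_mod_cast h1
    | succ k =>
      rw [expIdeal_eq_top (by lia)]
      simpa [hilbPoly, revStirling] using HilbertBound.top
  | succ n ih =>
    cases k with
    | zero =>
      have : expIdeal r (n + 1) (fun _ => 0 * r) 0 = ⊤ := by
        rw [Ideal.eq_top_iff_one, ← pow_zero (X 0)]
        exact X_pow_mem_expIdeal _ (by simp)
      rw [this]
      simpa [hilbPoly, revStirling] using HilbertBound.top
    | succ k =>
      rw [hilbPoly_succ]
      exact ((ih (k + 1)).expIdeal_esymmPow (ih k)).expIdeal_filtration hr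

theorem sum_choose_succ {A : Type*} [CommSemiring A] (t : ℕ) (x : A) (u : ℕ → A) :
    ∑ z ∈ Finset.range (t + 1 + 1), ((t + 1).choose z : A) * x ^ z * u z =
      ∑ z ∈ Finset.range (t + 1), (t.choose z : A) * x ^ z * u z +
        x * ∑ z ∈ Finset.range (t + 1), (t.choose z : A) * x ^ z * u (z + 1) := by
  rw [Finset.sum_range_succ', Finset.sum_congr rfl fun z _ => by
    rw [Nat.choose_succ_succ, Nat.cast_add, add_mul, add_mul], Finset.sum_add_distrib,
    Finset.mul_sum]
  have h : ∑ z ∈ Finset.range (t + 1), (t.choose z : A) * x ^ z * u z =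
      ∑ z ∈ Finset.range (t + 1), (t.choose (z + 1) : A) * x ^ (z + 1) * u (z + 1) + u 0 := by
    have := Finset.sum_range_succ' (fun z => (t.choose z : A) * x ^ z * u z) (t + 1)
    rw [Finset.sum_range_succ] at this
    simpa using this
  have h' : ∀ z, (t.choose z : A) * x ^ (z + 1) * u (z + 1) =
      x * ((t.choose z : A) * x ^ z * u (z + 1)) := fun z => by ring
  simp only [h, h', Nat.succ_eq_add_one, Nat.choose_zero_right, Nat.cast_one, pow_zero, one_mul]
  ring

/-- The bound for the ideal in which the first `t` exponents are raised by one. -/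
theorem hilbertBound_raised {r : ℕ} (hr : 0 < r) (k : ℕ) {n t : ℕ} (ht : t ≤ n) :
    HilbertBound (expIdeal r n (fun i => k * r + if i.val < t then 1 else 0) k)
      (∑ z ∈ Finset.range (t + 1), (t.choose z : Polynomial ℤ) * (Polynomial.X ^ (k * r)) ^ z *
        hilbPoly r (n - z) k) := by
  induction t generalizing n with
  | zero => simpa using hilbertBound_const hr n k
  | succ t ih =>
    obtain ⟨n, rfl⟩ := Nat.exists_eq_add_of_le' (show 1 ≤ n by lia)
    rw [sum_choose_succ]
    simp only [Nat.add_sub_add_right]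
    set I := expIdeal r (n + 1) (fun i => k * r + if i.val < t + 1 then 1 else 0) k with hI
    let i : Fin (n + 1) := ⟨t, by lia⟩
    -- Adding `x_i^{kr}` undoes the raise at the index `i = t`. The colon ideal contains `x_i` and,
    -- by the descent with `j = k`, the symmetric generators in the other variables, so `x_i` can be
    -- deleted.
    refine HilbertBound.of_colon (K := colonIdeal (X i ^ (k * r)) I)
      homogeneousComponent_mem_expIdeal (isHomogeneous_X_pow i (k * r))
      ((ih (show t ≤ n + 1 by lia)).anti (expIdeal_le (fun j => ?_) fun d hd => ?_))
      ((ih (show t ≤ n by lia)).of_succAbove i ?_ (expIdeal_le (fun j => ?_) fun d hd => ?_))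
      fun p hp => hp
    · by_cases hj : j = i
      · subst hj
        refine Ideal.mem_sup_right (Ideal.mem_of_dvd _ (pow_dvd_pow _ (Nat.le_add_right _ _))
          (Ideal.mem_span_singleton_self _))
      · have : j.val ≠ t := fun h => hj (Fin.ext h)
        refine Ideal.mem_sup_left (X_pow_mem_expIdeal _ ?_)
        split_ifs <;> lia
    · exact Ideal.mem_sup_left (esymmPow_mem_expIdeal hd)
    · rw [mem_colonIdeal, ← pow_succ]
      exact X_pow_mem_expIdeal _ (by simp [i])
    · rw [Ideal.mem_comap, mem_colonIdeal, map_pow, rename_X]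
      refine Ideal.mul_mem_left _ _ (X_pow_mem_expIdeal _ ?_)
      -- Deleting the index `t` leaves exactly the first `t` exponents raised.
      have : (i.succAbove j).val < t + 1 ↔ j.val < t := by
        simp only [Fin.succAbove, Fin.lt_def, i]
        split_ifs with h
        all_goals
          simp at h ⊢
          try lia
      simp only [this, le_refl]
    · rw [Ideal.mem_comap, mem_colonIdeal]
      exact X_pow_mul_rename_esymmPow_mem (fun d => esymmPow_mem_expIdeal) i le_rfl hd

end WreathCoinvariant

/-! ### Lower bounds from finite point sets and leading forms. -/

namespace WreathCoinvariant

open MvPolynomial Module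

section Points

variable {n : ℕ} {ι : Type*} (y : ι → Fin n → ℂ)

/-- Evaluation of polynomials at a family of points. -/
noncomputable def evalPoints : MvPolynomial (Fin n) ℂ →ₗ[ℂ] (ι → ℂ) :=
  LinearMap.pi fun a => (aeval (y a)).toLinearMap

@[simp] theorem evalPoints_apply (p : MvPolynomial (Fin n) ℂ) (a : ι) :
    evalPoints y p a = aeval (y a) p := rfl

/-- The functions on the points given by polynomials of degree less than `d`. -/
noncomputable def evalFiltration : ℕ → Submodule ℂ (ι → ℂ)
  | 0 => ⊥
  | d + 1 => evalFiltration d ⊔ (homogeneousSubmodule (Fin n) ℂ d).map (evalPoints y)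

theorem evalFiltration_mono : Monotone (evalFiltration y) :=
  monotone_nat_of_le_succ fun _ => le_sup_left

theorem evalPoints_mem_evalFiltration {p : MvPolynomial (Fin n) ℂ} {c d : ℕ}
    (hp : p.IsHomogeneous c) (h : c < d) : evalPoints y p ∈ evalFiltration y d :=
  evalFiltration_mono y h (Submodule.mem_sup_right ⟨p, hp, rfl⟩)

theorem X_mul_mem_evalFiltration (i : Fin n) (d : ℕ) :
    evalFiltration y d ≤
      (evalFiltration y (d + 1)).comap (LinearMap.mulLeft ℂ (fun a => y a i)) := by
  induction d with
  | zero => exact bot_le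
  | succ d ih =>
    refine sup_le (ih.trans (Submodule.comap_mono (evalFiltration_mono y (Nat.le_succ _)))) ?_
    rintro _ ⟨p, hp, rfl⟩
    have h := evalPoints_mem_evalFiltration y ((isHomogeneous_X ℂ i).mul hp)
      (show 1 + d < d + 1 + 1 by lia)
    have e : evalPoints y (X i * p) = (fun a => y a i) * evalPoints y p := by
      ext a
      simp
    rwa [e] at h

/-- The polynomials whose homogeneous components are leading forms of polynomials that vanish at
the points. -/
noncomputable def leadingIdeal : Ideal (MvPolynomial (Fin n) ℂ) where
  carrier := {p | ∀ d, evalPoints y (homogeneousComponent d p) ∈ evalFiltration y d}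
  add_mem' {p q} hp hq d := by
    rw [map_add, map_add]
    exact add_mem (hp d) (hq d)
  zero_mem' d := by simp
  smul_mem' a p hp := by
    induction a using MvPolynomial.induction_on generalizing p with
    | C c =>
      intro d
      rw [smul_eq_mul, homogeneousComponent_C_mul, ← smul_eq_C_mul, map_smul]
      exact Submodule.smul_mem _ _ (hp d)
    | add a b iha ihb =>
      intro d
      rw [add_smul, map_add, map_add]
      exact add_mem (iha p hp d) (ihb p hp d)
    | mul_X a i ih =>
      rw [mul_smul]
      refine ih _ fun d => ?_
      rw [smul_eq_mul]
      cases d with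
      | zero =>
        rw [homogeneousComponent_mul_of_lt (isHomogeneous_X ℂ i) _ Nat.one_pos, map_zero]
        exact zero_mem _
      | succ d =>
        rw [homogeneousComponent_add_mul (isHomogeneous_X ℂ i)]
        have e : evalPoints y (X i * homogeneousComponent d p) =
            (fun a => y a i) * evalPoints y (homogeneousComponent d p) := by
          ext a
          simp
        rw [e]
        exact X_mul_mem_evalFiltration y i d (hp d)

theorem mem_leadingIdeal {p : MvPolynomial (Fin n) ℂ} {e : ℕ} (hp : p.IsHomogeneous e)
    (h : evalPoints y p ∈ evalFiltration y e) : p ∈ leadingIdeal y := by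
  intro d
  rw [homogeneousComponent_of_mem hp]
  split_ifs with hd
  · exact hd ▸ h
  · simp

/-- The step from `D` to `D + 1` of the filtration is a quotient of the forms of degree `D`, and
forms in `I` die there because their values are also taken by polynomials of lower degree. -/
theorem finrank_evalFiltration_le [Finite ι] {I : Ideal (MvPolynomial (Fin n) ℂ)}
    (hI : I ≤ leadingIdeal y) (D : ℕ) :
    finrank ℂ (evalFiltration y D) ≤ ∑ d ∈ Finset.range D, finrank ℂ (gradedPart I d) := by
  induction D with
  | zero =>
    rw [evalFiltration, finrank_bot]
    exact Nat.zero_le _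
  | succ D ih =>
    rw [Finset.sum_range_succ]
    have h1 := finrank_le_map_add_inf_ker (evalFiltration y (D + 1)) (evalFiltration y D).mkQ
      (evalFiltration y D) fun p _ hp => by simpa using hp
    have h2 : (evalFiltration y (D + 1)).map (evalFiltration y D).mkQ =
        (homogeneousSubmodule (Fin n) ℂ D).map ((evalFiltration y D).mkQ ∘ₗ evalPoints y) := by
      rw [evalFiltration, Submodule.map_sup, Submodule.mkQ_map_self, bot_sup_eq,
        Submodule.map_comp]
    have h3 : finrank ℂ ((homogeneousSubmodule (Fin n) ℂ D).map
        ((evalFiltration y D).mkQ ∘ₗ evalPoints y)) ≤ finrank ℂ (gradedPart I D) := by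
      refine finrank_map_le_of_forall _ _ _ fun p hp h => ?_
      have h : Ideal.Quotient.mk I p = 0 := h
      rw [Ideal.Quotient.eq_zero_iff_mem] at h
      have := hI h D
      rw [homogeneousComponent_eq_self hp] at this
      simpa using this
    rw [h2] at h1
    lia

/-- Polynomial interpolation at finitely many points. -/
theorem exists_evalPoints_eq_single [Fintype ι] [DecidableEq ι] (hy : Function.Injective y)
    (a : ι) : ∃ p : MvPolynomial (Fin n) ℂ, evalPoints y p = Pi.single a 1 := by
  have h : ∀ b, ∃ p : MvPolynomial (Fin n) ℂ, aeval (y a) p = (1 : ℂ) ∧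
      (b ≠ a → aeval (y b) p = (0 : ℂ)) := by
    intro b
    by_cases hb : b = a
    · exact ⟨1, by simp, fun h => absurd hb h⟩
    · obtain ⟨i, hi⟩ := Function.ne_iff.1 (hy.ne hb)
      refine ⟨C (y a i - y b i)⁻¹ * (X i - C (y b i)), ?_, fun _ => ?_⟩
      · simpa using inv_mul_cancel₀ (sub_ne_zero.2 hi.symm)
      · simp
  choose p hp1 hp2 using h
  refine ⟨∏ b, p b, funext fun b => ?_⟩
  rw [evalPoints_apply, map_prod]
  by_cases hb : b = a
  · subst hb
    simp [hp1]
  · rw [Pi.single_eq_of_ne hb]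
    exact Finset.prod_eq_zero (Finset.mem_univ b) (hp2 b hb)

theorem exists_evalFiltration_eq_top [Fintype ι] (hy : Function.Injective y) :
    ∃ D₀, ∀ D, D₀ ≤ D → evalFiltration y D = ⊤ := by
  classical
  choose p hp using exists_evalPoints_eq_single y hy
  refine ⟨∑ a, ((p a).totalDegree + 1), fun D hD => ?_⟩
  have h : ∀ a, Pi.single a 1 ∈ evalFiltration y D := by
    intro a
    have ha : (p a).totalDegree + 1 ≤ D :=
      (Finset.single_le_sum (f := fun a => (p a).totalDegree + 1) (fun _ _ => Nat.zero_le _)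
        (Finset.mem_univ a)).trans hD
    rw [← hp a, ← sum_homogeneousComponent (p a), map_sum]
    refine Submodule.sum_mem _ fun j hj => evalPoints_mem_evalFiltration y
      (homogeneousComponent_isHomogeneous j _) ?_
    rw [Finset.mem_range] at hj
    lia
  rw [eq_top_iff]
  intro v _
  rw [pi_eq_sum_univ' v]
  refine Submodule.sum_mem _ fun a _ => Submodule.smul_mem _ _ ?_
  convert h a using 1

/-- If the Hilbert series is bounded by `P`, `I` consists of leading forms of
polynomials that vanish at certain points, and there are at least `P(1)` points, the bound is sharp. -/
theorem HilbertBound.eq_coeff [Fintype ι] (hy : Function.Injective y)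
    {I : Ideal (MvPolynomial (Fin n) ℂ)} (hI : I ≤ leadingIdeal y) {P : Polynomial ℤ}
    (hP : HilbertBound I P) (hc : P.eval 1 ≤ Fintype.card ι) (d : ℕ) :
    (finrank ℂ (gradedPart I d) : ℤ) = P.coeff d := by
  obtain ⟨D₀, hD₀⟩ := exists_evalFiltration_eq_top y hy
  -- Large enough that polynomials of degree below `D` interpolate everything, that `P(1)` is the
  -- sum of the first `D` coefficients, and that `d` is among the degrees summed.
  set D := D₀ + (P.natDegree + 1) + (d + 1) with hD
  have h1 := finrank_evalFiltration_le y hI D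
  rw [hD₀ D (by lia), finrank_top, Module.finrank_fintype_fun_eq_card] at h1
  rw [Polynomial.eval_eq_sum_range' (show P.natDegree < D by lia)] at hc
  simp only [one_pow, mul_one] at hc
  refine le_antisymm (hP d) (not_lt.1 fun hlt => ?_)
  have h2 : ∑ d ∈ Finset.range D, (finrank ℂ (gradedPart I d) : ℤ) <
      ∑ d ∈ Finset.range D, P.coeff d :=
    Finset.sum_lt_sum (fun d _ => hP d) ⟨d, Finset.mem_range.2 (by lia), hlt⟩
  have h3 : (Fintype.card ι : ℤ) ≤ ∑ d ∈ Finset.range D, (finrank ℂ (gradedPart I d) : ℤ) := by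
    exact_mod_cast h1
  lia

/-- On the points, `Q(x_i) = 0` expresses the top power of `x_i` through lower ones. -/
theorem X_pow_mem_leadingIdeal {Q : Polynomial ℂ} (hQ : Q.Monic) (i : Fin n)
    (h : ∀ a, Q.eval (y a i) = 0) : X i ^ Q.natDegree ∈ leadingIdeal y := by
  refine mem_leadingIdeal y (isHomogeneous_X_pow i _) ?_
  have : evalPoints y (X i ^ Q.natDegree) =
      -∑ j ∈ Finset.range Q.natDegree, Q.coeff j • evalPoints y (X i ^ j) := by
    ext a
    have h1 := h a
    rw [hQ.as_sum, Polynomial.eval_add, Polynomial.eval_finsetSum] at h1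
    simp only [Polynomial.eval_mul, Polynomial.eval_pow, Polynomial.eval_X,
      Polynomial.eval_C] at h1
    simpa using eq_neg_of_add_eq_zero_left h1
  rw [this]
  refine neg_mem (Submodule.sum_mem _ fun j hj => Submodule.smul_mem _ _ ?_)
  exact evalPoints_mem_evalFiltration y (isHomogeneous_X_pow i j) (Finset.mem_range.1 hj)

/-- The coefficients `c` do not depend on the point, so the relation expresses `e_d` on the points
through the `e_j` with `j < d`, whose degrees are lower as `r > 0`. -/
theorem esymmPow_mem_leadingIdeal {r d : ℕ} (hr : 0 < r) {c : ℕ → ℂ} (hc : c 0 = 1)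
    (h : ∀ a, ∑ x ∈ Finset.HasAntidiagonal.antidiagonal d, c x.1 * aeval (y a) (esymmPow r n x.2) = 0) :
    esymmPow r n d ∈ leadingIdeal y := by
  refine mem_leadingIdeal y (esymmPow_isHomogeneous r n d) ?_
  have : evalPoints y (esymmPow r n d) =
      -∑ x ∈ (Finset.HasAntidiagonal.antidiagonal d).erase (0, d), c x.1 • evalPoints y (esymmPow r n x.2) := by
    ext a
    have h1 := h a
    rw [← Finset.add_sum_erase _ _ (show (0, d) ∈ Finset.HasAntidiagonal.antidiagonal d by simp), hc,
      one_mul] at h1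
    simpa using eq_neg_of_add_eq_zero_left h1
  rw [this]
  refine neg_mem (Submodule.sum_mem _ fun x hx => Submodule.smul_mem _ _ ?_)
  refine evalPoints_mem_evalFiltration y (esymmPow_isHomogeneous r n x.2)
    (Nat.mul_lt_mul_of_pos_right ?_ hr)
  obtain ⟨h1, h2⟩ := Finset.mem_erase.1 hx
  rw [Finset.HasAntidiagonal.mem_antidiagonal] at h2
  by_contra h3
  exact h1 (Prod.ext (by lia) (by lia))

end Points

theorem coeff_prod_one_add {σ : Type*} (s : Finset σ) (c : σ → ℂ) (d : ℕ) :
    (∏ i ∈ s, (1 + Polynomial.C (c i) * Polynomial.X)).coeff d =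
      ∑ t ∈ s.powersetCard d, ∏ i ∈ t, c i := by
  classical
  rw [Finset.prod_one_add, Polynomial.finsetSum_coeff, Finset.powersetCard_eq_filter,
    Finset.sum_filter]
  refine Finset.sum_congr rfl fun t _ => ?_
  rw [Finset.prod_mul_distrib, Finset.prod_const, ← map_prod, Polynomial.coeff_C_mul_X_pow]
  simp only [eq_comm]

theorem aeval_esymmPow (r n d : ℕ) (x : Fin n → ℂ) :
    aeval x (esymmPow r n d) =
      (∏ i, (1 + Polynomial.C (x i ^ r) * Polynomial.X)).coeff d := by
  rw [coeff_prod_one_add]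
  simp [esymmPow]

theorem natDegree_prod_one_add_le {σ : Type*} (s : Finset σ) (c : σ → ℂ) :
    (∏ i ∈ s, (1 + Polynomial.C (c i) * Polynomial.X)).natDegree ≤ s.card := by
  refine Polynomial.natDegree_le_iff_coeff_eq_zero.2 fun d hd => ?_
  rw [coeff_prod_one_add, Finset.powersetCard_eq_empty.2 hd, Finset.sum_empty]

/-- If the `r`-th powers of the coordinates take all the values `α j`, the elementary symmetric
functions of these powers satisfy linear relations that depend on `α` only. -/
theorem sum_inv_mul_esymmPow_eq_zero {r n k d : ℕ} {α : Fin k → ℂ} (hα : Function.Injective α)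
    (hd : n < d + k) {x : Fin n → ℂ} (hx : ∀ j, ∃ i, x i ^ r = α j) :
    ∑ u ∈ Finset.HasAntidiagonal.antidiagonal d,
      PowerSeries.coeff u.1 ((∏ j, (1 + Polynomial.C (α j) * Polynomial.X) : Polynomial ℂ) :
        PowerSeries ℂ)⁻¹ * aeval x (esymmPow r n u.2) = 0 := by
  classical
  choose f hf using hx
  have hfi : Function.Injective f := fun a b h => hα (by rw [← hf, ← hf, h])
  have hcard := Finset.card_image_of_injective (Finset.univ : Finset (Fin k)) hfi
  set s := (Finset.univ : Finset (Fin k)).image f with hs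
  set A : Polynomial ℂ := ∏ j, (1 + Polynomial.C (α j) * Polynomial.X) with hA
  -- The generating function of the `e_d` is divisible by `A`, which depends only on `α`. The
  -- cofactor has degree at most `n - k < d`, so its coefficient at `d` is zero.
  have h1 : (∏ i, (1 + Polynomial.C (x i ^ r) * Polynomial.X)) =
      A * ∏ i ∈ sᶜ, (1 + Polynomial.C (x i ^ r) * Polynomial.X) := by
    rw [← Finset.prod_mul_prod_compl s, hs, Finset.prod_image fun a _ b _ h => hfi h]
    simp only [hf, hA]
  have hA0 : PowerSeries.constantCoeff (A : PowerSeries ℂ) ≠ 0 := by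
    have : A.coeff 0 = 1 := by rw [hA, coeff_prod_one_add]; simp
    simp [this]
  simp only [aeval_esymmPow, ← Polynomial.coeff_coe]
  rw [← PowerSeries.coeff_mul, h1, Polynomial.coe_mul, ← mul_assoc, PowerSeries.inv_mul_cancel _ hA0,
    one_mul, Polynomial.coeff_coe]
  refine Polynomial.coeff_eq_zero_of_natDegree_lt ((natDegree_prod_one_add_le _ _).trans_lt ?_)
  rw [Finset.card_compl, hcard, Finset.card_univ, Fintype.card_fin, Fintype.card_fin]
  have : k ≤ n := by simpa using Fintype.card_le_of_injective f hfi
  lia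

/-- A sharp bound from the points whose coordinates come from the values `v` and hit all the
classes. -/
theorem HilbertBound.eq_coeff_of_values {r n k m : ℕ} (hr : 0 < r) {β : Type*} [Fintype β]
    {v : β → ℂ} (hv : Function.Injective v) (π : β → Option (Fin k)) {α : Fin k → ℂ}
    (hα : Function.Injective α) (hπ : ∀ b j, π b = some j → v b ^ r = α j) {Q : Polynomial ℂ}
    (hQ : Q.Monic) (hm : Q.natDegree = m) (hQv : ∀ b, Q.eval (v b) = 0) {P : Polynomial ℤ}
    (hP : HilbertBound (expIdeal r n (fun _ => m) k) P)
    (hc : P.eval 1 ≤ Nat.card {p : Fin n → β // ∀ j : Fin k, ∃ i, π (p i) = some j}) (d : ℕ) :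
    (finrank ℂ (gradedPart (expIdeal r n (fun _ => m) k) d) : ℤ) = P.coeff d := by
  classical
  subst hm
  let y : {p : Fin n → β // ∀ j : Fin k, ∃ i, π (p i) = some j} → Fin n → ℂ :=
    fun p i => v (p.1 i)
  rw [Nat.card_eq_fintype_card] at hc
  refine hP.eq_coeff y (fun p q h => Subtype.ext (funext fun i => hv (congrFun h i)))
    (expIdeal_le (fun i => X_pow_mem_leadingIdeal y hQ i fun p => hQv _) fun d hd => ?_) hc d
  refine esymmPow_mem_leadingIdeal y hr (c := fun j => PowerSeries.coeff j
    ((∏ j, (1 + Polynomial.C (α j) * Polynomial.X) : Polynomial ℂ) : PowerSeries ℂ)⁻¹) ?_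
    fun p => sum_inv_mul_esymmPow_eq_zero hα hd fun j => ?_
  · rw [PowerSeries.coeff_zero_eq_constantCoeff_apply, PowerSeries.constantCoeff_inv,
      Polynomial.constantCoeff_coe, coeff_prod_one_add]
    simp
  · obtain ⟨i, hi⟩ := p.2 j
    exact ⟨i, hπ _ _ hi⟩

end WreathCoinvariant

/-! ### Counting the points: words that hit all classes. -/

namespace WreathCoinvariant

/-- The number of words of length `n` in `B` letters that hit `a` given disjoint classes of `r`
letters. -/
def hitCount (r : ℕ) : ℕ → ℕ → ℤ → ℤ
  | 0, 0, _ => 1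
  | 0, _ + 1, _ => 0
  | n + 1, a, B => r * a * hitCount r n (a - 1) B + (B - r * a) * hitCount r n a B

/-- Induction on the first letter: if its class lies in `A`, that class is removed from the
requirements; otherwise `A` is unchanged. -/
theorem sum_ite_hit_eq_hitCount {r k : ℕ} {β : Type*} [Fintype β] [DecidableEq β]
    (π : β → Option (Fin k)) (hπ : ∀ j, (Finset.univ.filter fun b => π b = some j).card = r)
    (n : ℕ) (A : Finset (Fin k)) :
    ∑ p : Fin n → β, (if ∀ j ∈ A, ∃ i, π (p i) = some j then (1 : ℤ) else 0) =
      hitCount r n A.card (Fintype.card β) := by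
  induction n generalizing A with
  | zero =>
    rcases h : A.card with _ | a
    · rw [Finset.card_eq_zero] at h
      simp [h, hitCount]
    · obtain ⟨j, hj⟩ : A.Nonempty := Finset.card_pos.1 (by lia)
      rw [hitCount]
      refine Finset.sum_eq_zero fun p _ => if_neg fun hp => ?_
      obtain ⟨i, -⟩ := hp j hj
      exact i.elim0
  | succ n ih =>
    rw [← (Fin.consEquiv fun _ : Fin (n + 1) => β).sum_comp, Fintype.sum_prod_type]
    have h1 : ∀ b : β, ∑ p : Fin n → β, (if ∀ j ∈ A, ∃ i,
        π ((Fin.consEquiv fun _ : Fin (n + 1) => β) (b, p) i) = some j then (1 : ℤ) else 0) =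
        hitCount r n A.card (Fintype.card β) + ∑ j ∈ A, if π b = some j then
          hitCount r n (A.card - 1) (Fintype.card β) - hitCount r n A.card (Fintype.card β)
          else 0 := by
      intro b
      have h2 : ∀ p : Fin n → β, (∀ j ∈ A, ∃ i,
          π ((Fin.consEquiv fun _ : Fin (n + 1) => β) (b, p) i) = some j) ↔
          ∀ j ∈ A.filter (fun j => π b ≠ some j), ∃ i, π (p i) = some j := by
        intro p
        refine forall_congr' fun j => ?_
        rw [Finset.mem_filter, and_imp]
        refine imp_congr_right fun _ => ?_
        rw [Fin.exists_fin_succ]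
        simp only [Fin.consEquiv_apply, Fin.cons_zero, Fin.cons_succ]
        tauto
      simp only [h2]
      rw [ih]
      by_cases hb : ∃ j ∈ A, π b = some j
      · obtain ⟨j, hj, hb⟩ := hb
        have h3 : A.filter (fun j => π b ≠ some j) = A.erase j := by
          ext l
          simp only [Finset.mem_filter, Finset.mem_erase, hb, ne_eq, Option.some.injEq]
          tauto
        rw [h3, Finset.card_erase_of_mem hj]
        simp [hb, hj]
      · push Not at hb
        rw [Finset.filter_true_of_mem hb, Finset.sum_eq_zero fun j hj => if_neg (hb j hj), add_zero]
    simp only [h1]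
    rw [Finset.sum_add_distrib, Finset.sum_comm]
    simp only [← Finset.sum_filter, Finset.sum_const, hπ, Finset.card_univ, nsmul_eq_mul]
    rw [hitCount]
    ring

theorem natCard_hit_eq_hitCount {r k : ℕ} {β : Type*} [Fintype β] (π : β → Option (Fin k))
    (hπ : ∀ j, Nat.card {b // π b = some j} = r) (n : ℕ) :
    (Nat.card {p : Fin n → β // ∀ j : Fin k, ∃ i, π (p i) = some j} : ℤ) =
      hitCount r n k (Fintype.card β) := by
  classical
  have h := sum_ite_hit_eq_hitCount (r := r) π (fun j => by
    rw [← hπ j, Nat.card_eq_fintype_card, Fintype.card_subtype]) n Finset.univ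
  rw [Finset.card_univ, Fintype.card_fin] at h
  rw [← h, Nat.card_eq_fintype_card, Fintype.card_subtype, Finset.sum_boole]
  simp

/-- Words hitting `a` classes either hit one further class or avoid its `r` letters. -/
theorem hitCount_add (r n a : ℕ) (B : ℤ) :
    hitCount r n (a + 1) B + hitCount r n a (B - r) = hitCount r n a B := by
  induction n generalizing a with
  | zero => cases a <;> simp [hitCount]
  | succ n ih =>
    cases a with
    | zero =>
      simp only [hitCount]
      have := ih 0
      push_cast
      simp only [zero_add] at *
      linear_combination (B - r) * this
    | succ a =>
      simp only [hitCount, Nat.add_sub_cancel]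
      have h1 := ih a
      have h2 := ih (a + 1)
      push_cast
      linear_combination (B - r - r * (a + 1)) * h2 + r * (a + 1) * h1

/-- Here `w` is the number of letters outside the classes. The alphabet now shrinks with `a`, as in
the recursion of `hilbPoly` at `q = 1`; `w = 0` serves `S` and `w = 1` serves `R`. -/
theorem hitCount_succ (r n a : ℕ) (w : ℤ) :
    hitCount r (n + 1) (a + 1) (w + r * (a + 1)) =
      (w + r * (a + 1)) * hitCount r n (a + 1) (w + r * (a + 1)) +
        r * (a + 1) * hitCount r n a (w + r * a) := by
  have h := hitCount_add r n a (w + r * (a + 1))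
  rw [show w + r * (a + 1) - r = w + r * (a : ℤ) by ring] at h
  rw [hitCount, Nat.add_sub_cancel, ← h]
  push_cast
  ring

theorem eval_one_qInt (m : ℕ) : (qInt (Polynomial.X : Polynomial ℤ) m).eval 1 = m := by
  simp [qInt, Polynomial.eval_finsetSum]

theorem eval_one_hilbPoly_succ (r n k : ℕ) : (hilbPoly r (n + 1) (k + 1)).eval 1 =
    (k + 1) * r * ((hilbPoly r n (k + 1)).eval 1 + (hilbPoly r n k).eval 1) := by
  rw [hilbPoly_succ, Polynomial.eval_mul, eval_one_qInt]
  simp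

theorem hilbPoly_zero_zero (r : ℕ) : hilbPoly r 0 0 = 1 := by
  simp [hilbPoly, revStirling, qFactorial]

theorem hilbPoly_zero_succ (r k : ℕ) : hilbPoly r 0 (k + 1) = 0 := by
  simp [hilbPoly, revStirling]

theorem hilbPoly_succ_zero (r n : ℕ) : hilbPoly r (n + 1) 0 = 0 := by
  simp [hilbPoly, revStirling]

theorem eval_one_hilbPoly (r n k : ℕ) :
    (hilbPoly r n k).eval 1 = hitCount r n k (r * k) := by
  induction n generalizing k with
  | zero => cases k <;> simp [hilbPoly_zero_zero, hilbPoly_zero_succ, hitCount]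
  | succ n ih =>
    cases k with
    | zero => simp [hilbPoly_succ_zero, hitCount]
    | succ k =>
      have h := hitCount_succ r n k 0
      simp only [zero_add] at h
      rw [eval_one_hilbPoly_succ, ih, ih]
      push_cast
      rw [h]
      ring

/-- Combinatorially, `z` is the number of places holding the one letter outside the classes. The
proof compares recursions, using Pascal's rule and `hitCount_succ` with `w = 1`. -/
theorem sum_choose_eval_one_hilbPoly (r n k : ℕ) :
    ∑ z ∈ Finset.range (n + 1), (n.choose z : ℤ) * (hilbPoly r (n - z) k).eval 1 =
      hitCount r n k (r * k + 1) := by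
  induction n generalizing k with
  | zero => cases k <;> simp [hilbPoly_zero_zero, hilbPoly_zero_succ, hitCount]
  | succ n ih =>
    have h := sum_choose_succ n (1 : ℤ) fun z => (hilbPoly r (n + 1 - z) k).eval 1
    simp only [one_pow, mul_one, one_mul, Nat.add_sub_add_right] at h
    rw [h, ih]
    cases k with
    | zero =>
      rw [Finset.sum_eq_zero]
      · simp [hitCount]
      · intro z hz
        rw [Nat.succ_sub (by simpa [Nat.lt_succ_iff] using hz), hilbPoly_succ_zero]
        simp
    | succ k =>
      have h1 : ∀ z ∈ Finset.range (n + 1),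
          (n.choose z : ℤ) * (hilbPoly r (n + 1 - z) (k + 1)).eval 1 =
          (k + 1) * r * ((n.choose z : ℤ) * (hilbPoly r (n - z) (k + 1)).eval 1) +
          (k + 1) * r * ((n.choose z : ℤ) * (hilbPoly r (n - z) k).eval 1) := by
        intro z hz
        rw [Nat.succ_sub (by simpa [Nat.lt_succ_iff] using hz), eval_one_hilbPoly_succ]
        ring
      rw [Finset.sum_congr rfl h1, Finset.sum_add_distrib, ← Finset.mul_sum, ← Finset.mul_sum, ih,
        ih]
      have h2 := hitCount_succ r n k 1
      rw [add_comm 1 _, add_comm 1 _] at h2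
      push_cast
      rw [h2]
      ring

/-! ### Reversal of the `q`-analogues. -/

section Reverse

open Polynomial

theorem reflect_finsetSum {σ : Type*} (N : ℕ) (s : Finset σ) (f : σ → ℤ[X]) :
    reflect N (∑ i ∈ s, f i) = ∑ i ∈ s, reflect N (f i) := by
  ext
  simp [coeff_reflect, finsetSum_coeff]

theorem natDegree_qInt_le (s m : ℕ) : (qInt (X ^ s : ℤ[X]) (m + 1)).natDegree ≤ s * m := by
  refine natDegree_sum_le_of_forall_le _ _ fun i hi => ?_
  rw [← pow_mul, natDegree_X_pow]
  exact Nat.mul_le_mul_left _ (by simpa [Nat.lt_succ_iff] using hi)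

theorem reflect_qInt (s m : ℕ) :
    reflect (s * m) (qInt (X ^ s : ℤ[X]) (m + 1)) = qInt (X ^ s : ℤ[X]) (m + 1) := by
  rw [qInt, reflect_finsetSum, ← Finset.sum_range_reflect]
  refine Finset.sum_congr rfl fun i hi => ?_
  have hi : i ≤ m := by simpa [Nat.lt_succ_iff] using hi
  rw [← pow_mul, ← pow_mul, reflect_monomial, revAt_le (Nat.mul_le_mul_left _ (by lia)),
    ← Nat.mul_sub]
  congr 2
  lia

theorem coeff_zero_qInt {s : ℕ} (hs : 0 < s) (m : ℕ) :
    (qInt (X ^ s : ℤ[X]) (m + 1)).coeff 0 = 1 := by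
  rw [coeff_zero_eq_eval_zero, qInt, eval_finsetSum, Finset.sum_range_succ']
  simp [hs.ne']

/-- A polynomial of degree at most `N` whose reflection has nonzero constant coefficient has the
same reverse and reflection. -/
theorem reverse_eq_reflect {f : ℤ[X]} {N : ℕ} (hN : f.natDegree ≤ N)
    (h : (reflect N f).coeff 0 ≠ 0) : reverse f = reflect N f := by
  rw [coeff_reflect, revAt_zero] at h
  rw [reverse, le_antisymm hN (le_natDegree_of_ne_zero h)]

theorem reverse_qInt {s : ℕ} (hs : 0 < s) (m : ℕ) :
    reverse (qInt (X ^ s : ℤ[X]) m) = qInt (X ^ s : ℤ[X]) m := by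
  cases m with
  | zero => simp [qInt]
  | succ m =>
    have h := reverse_eq_reflect (natDegree_qInt_le s m)
      (by rw [reflect_qInt, coeff_zero_qInt hs]; exact one_ne_zero)
    rw [h, reflect_qInt]

theorem reverse_qFactorial {s : ℕ} (hs : 0 < s) (m : ℕ) :
    reverse (qFactorial (X ^ s : ℤ[X]) m) = qFactorial (X ^ s : ℤ[X]) m := by
  induction m with
  | zero => simpa [qFactorial] using reverse_C (1 : ℤ)
  | succ m ih =>
    rw [qFactorial, Finset.prod_range_succ, ← qFactorial, reverse_mul_of_domain, ih,
      reverse_qInt hs]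

theorem reverse_qInt_pow (r m : ℕ) :
    reverse (qInt (X : ℤ[X]) r ^ m) = qInt (X : ℤ[X]) r ^ m := by
  induction m with
  | zero => simpa using reverse_C (1 : ℤ)
  | succ m ih =>
    have h := reverse_qInt Nat.one_pos r
    rw [pow_one] at h
    rw [pow_succ, reverse_mul_of_domain, ih, h]

theorem qStirling_eq_zero_of_lt {A : Type*} [CommSemiring A] (q : A) {n k : ℕ} (h : n < k) :
    qStirling q n k = 0 := by
  induction n generalizing k with
  | zero =>
    obtain ⟨k, rfl⟩ := Nat.exists_eq_add_of_le' h
    rfl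
  | succ n ih =>
    obtain ⟨k, rfl⟩ := Nat.exists_eq_add_of_le' (show 1 ≤ k by lia)
    rw [qStirling, ih (by lia), ih (by lia), mul_zero, add_zero]

theorem revStirling_eq_zero_of_lt (r : ℕ) {n k : ℕ} (h : n < k) : revStirling r n k = 0 := by
  induction n generalizing k with
  | zero =>
    obtain ⟨k, rfl⟩ := Nat.exists_eq_add_of_le' h
    rfl
  | succ n ih =>
    obtain ⟨k, rfl⟩ := Nat.exists_eq_add_of_le' (show 1 ≤ k by lia)
    rw [revStirling, ih (by lia), ih (by lia), mul_zero, mul_zero, add_zero]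

theorem qStirling_self {A : Type*} [CommSemiring A] (q : A) (n : ℕ) : qStirling q n n = 1 := by
  induction n with
  | zero => rfl
  | succ n ih => rw [qStirling, qStirling_eq_zero_of_lt q (Nat.lt_succ_self n), ih, mul_zero, zero_add]

theorem revStirling_self (r n : ℕ) : revStirling r n n = 1 := by
  induction n with
  | zero => rfl
  | succ n ih =>
    rw [revStirling, revStirling_eq_zero_of_lt r (Nat.lt_succ_self n), ih, Nat.sub_self]
    simp

theorem reflect_add_left {f : ℤ[X]} {N : ℕ} (h : f.natDegree ≤ N) (c : ℕ) :
    reflect (N + c) f = X ^ c * reflect N f := by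
  have := reflect_mul f 1 h (show (1 : ℤ[X]).natDegree ≤ c by simp)
  rw [mul_one, reflect_one] at this
  rw [this, mul_comm]

/-- Reflection in a fixed degree is additive, unlike reversal, so it can be carried through the
recursion. Reflecting in degree `rkc` produces the shift `q^{r(n-k)}` of `revStirling`; the constant
coefficient `1` shows that this degree is attained. -/
theorem reflect_qStirling {r : ℕ} (hr : 0 < r) (c k : ℕ) :
    (qStirling (X ^ r : ℤ[X]) (k + 1 + c) (k + 1)).natDegree ≤ r * k * c ∧
      reflect (r * k * c) (qStirling (X ^ r : ℤ[X]) (k + 1 + c) (k + 1)) =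
        revStirling r (k + 1 + c) (k + 1) ∧
      (revStirling r (k + 1 + c) (k + 1)).coeff 0 = 1 := by
  induction c generalizing k with
  | zero => simp [qStirling_self, revStirling_self]
  | succ c ihc =>
    induction k with
    | zero =>
      obtain ⟨h1, h2, h3⟩ := ihc 0
      have e : 0 + 1 + (c + 1) = (0 + 1 + c) + 1 := by lia
      have e' : 0 + 1 + c = c + 1 := by lia
      have h0 : qStirling (X ^ r : ℤ[X]) (0 + 1 + c) 0 = 0 := by rw [e']; rfl
      have h0' : revStirling r (0 + 1 + c) 0 = 0 := by rw [e']; rfl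
      have hq : qInt (X ^ r : ℤ[X]) (0 + 1) = 1 := by simp [qInt]
      rw [e, qStirling, revStirling, h0, h0', hq]
      simpa using ⟨by simpa using h1, by simpa using h2, h3⟩
    | succ k ihk =>
      obtain ⟨h1, h2, h3⟩ := ihc (k + 1)
      obtain ⟨g1, g2, g3⟩ := ihk
      have e : k + 1 + 1 + (c + 1) = (k + 1 + 1 + c) + 1 := by lia
      have e' : k + 1 + (c + 1) = k + 1 + 1 + c := by lia
      have e'' : k + 1 + 1 + c - (k + 1) = c + 1 := by lia
      have d1 : r * (k + 1) * (c + 1) = r * (k + 1) + r * (k + 1) * c := by ring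
      have d2 : r * (k + 1) * (c + 1) = r * k * (c + 1) + r * (c + 1) := by ring
      rw [e'] at g1 g2 g3
      rw [e, qStirling, revStirling, e'']
      refine ⟨(natDegree_add_le _ _).trans (max_le ?_ ?_), ?_, ?_⟩
      · rw [d1]
        exact natDegree_mul_le.trans (add_le_add (natDegree_qInt_le _ _) h1)
      · rw [d2]
        exact g1.trans (Nat.le_add_right _ _)
      · rw [reflect_add]
        congr 1
        · rw [d1, reflect_mul _ _ (natDegree_qInt_le _ _) h1, reflect_qInt, h2]
        · rw [d2, reflect_add_left g1, g2]
      · rw [coeff_add, mul_coeff_zero, mul_coeff_zero, h3, coeff_zero_qInt hr, coeff_X_pow,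
          if_neg (Nat.mul_pos hr (Nat.succ_pos c)).ne]
        simp

theorem reverse_qStirling {r : ℕ} (hr : 0 < r) (n k : ℕ) :
    reverse (qStirling (X ^ r : ℤ[X]) n k) = revStirling r n k := by
  rcases lt_or_ge n k with h | h
  · rw [qStirling_eq_zero_of_lt _ h, revStirling_eq_zero_of_lt _ h, reverse_zero]
  · obtain ⟨c, rfl⟩ := Nat.exists_eq_add_of_le h
    cases k with
    | zero =>
      cases c with
      | zero => simpa [qStirling_self, revStirling_self] using reverse_C (1 : ℤ)
      | succ c => exact reverse_zero
    | succ k =>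
      obtain ⟨h1, h2, h3⟩ := reflect_qStirling hr c k
      rw [reverse_eq_reflect h1 (by rw [h2, h3]; exact one_ne_zero), h2]

theorem reverse_eq_hilbPoly {r : ℕ} (hr : 0 < r) (n k : ℕ) :
    reverse (qInt (X : ℤ[X]) r ^ n * qFactorial (X ^ r : ℤ[X]) k *
      qStirling (X ^ r : ℤ[X]) n k) = hilbPoly r n k := by
  rw [reverse_mul_of_domain, reverse_mul_of_domain, reverse_qInt_pow, reverse_qFactorial hr,
    reverse_qStirling hr, hilbPoly]

end Reverse

end WreathCoinvariant

/-! ### The letters, and the Hilbert series of the two rings. -/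

namespace WreathCoinvariant

open Module

/-- The `k * r` nonzero letters: for each `j < k` the `r`-th roots of `(j + 1) ^ r`. -/
noncomputable def rootLetter (r k : ℕ) (b : Fin k × Fin r) : ℂ :=
  ((b.1.val : ℂ) + 1) * Complex.exp (2 * Real.pi * Complex.I / r) ^ b.2.val

theorem rootLetter_pow {r k : ℕ} (hr : 0 < r) (b : Fin k × Fin r) :
    rootLetter r k b ^ r = ((b.1.val : ℂ) + 1) ^ r := by
  rw [rootLetter, mul_pow, ← pow_mul, mul_comm b.2.val, pow_mul,
    (Complex.isPrimitiveRoot_exp r hr.ne').pow_eq_one, one_pow, mul_one]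

theorem norm_rootLetter {r k : ℕ} (hr : 0 < r) (b : Fin k × Fin r) :
    ‖rootLetter r k b‖ = b.1.val + 1 := by
  rw [rootLetter, norm_mul, norm_pow,
    (Complex.isPrimitiveRoot_exp r hr.ne').norm'_eq_one hr.ne', one_pow, mul_one]
  exact_mod_cast Complex.norm_natCast (b.1.val + 1)

/-- The norm recovers the class, and primitivity of the root of unity recovers the exponent. -/
theorem rootLetter_injective {r k : ℕ} (hr : 0 < r) : Function.Injective (rootLetter r k) := by
  intro a b h
  have h1 : a.1 = b.1 := by
    have := congrArg norm h
    rw [norm_rootLetter hr, norm_rootLetter hr] at this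
    exact Fin.ext (by exact_mod_cast add_right_cancel this)
  refine Prod.ext h1 (Fin.ext ?_)
  rw [rootLetter, rootLetter, h1] at h
  exact (Complex.isPrimitiveRoot_exp r hr.ne').pow_inj a.2.isLt b.2.isLt
    (mul_left_cancel₀ (Nat.cast_add_one_ne_zero _) h)

theorem rootLetter_ne_zero {r k : ℕ} (hr : 0 < r) (b : Fin k × Fin r) : rootLetter r k b ≠ 0 := by
  rw [← norm_ne_zero_iff, norm_rootLetter hr]
  positivity

theorem pow_add_one_injective {r k : ℕ} (hr : 0 < r) :
    Function.Injective fun j : Fin k => ((j.val : ℂ) + 1) ^ r := by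
  intro a b h
  have h : ((a.val : ℂ) + 1) ^ r = ((b.val : ℂ) + 1) ^ r := h
  have h : (a.val + 1) ^ r = (b.val + 1) ^ r := by exact_mod_cast h
  exact Fin.ext (by simpa using Nat.pow_left_injective hr.ne' h)

/-- The polynomial whose roots are the nonzero letters. -/
noncomputable def letterPoly (r k : ℕ) : Polynomial ℂ :=
  ∏ j : Fin k, (Polynomial.X ^ r - Polynomial.C (((j.val : ℂ) + 1) ^ r))

theorem letterPoly_monic {r k : ℕ} (hr : 0 < r) : (letterPoly r k).Monic :=
  Polynomial.monic_prod_of_monic _ _ fun _ _ => Polynomial.monic_X_pow_sub_C _ hr.ne'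

theorem natDegree_letterPoly {r k : ℕ} (hr : 0 < r) : (letterPoly r k).natDegree = k * r := by
  rw [letterPoly, Polynomial.natDegree_prod_of_monic _ _ fun _ _ =>
    Polynomial.monic_X_pow_sub_C _ hr.ne']
  simp only [Polynomial.natDegree_X_pow_sub_C]
  simp

theorem eval_letterPoly {r k : ℕ} (hr : 0 < r) (b : Fin k × Fin r) :
    (letterPoly r k).eval (rootLetter r k b) = 0 := by
  rw [letterPoly, Polynomial.eval_prod]
  refine Finset.prod_eq_zero (Finset.mem_univ b.1) ?_
  simp [rootLetter_pow hr]

theorem hilbS_eq {r n k : ℕ} (hr : 0 < r) (hk : k ≤ n) : hilbS r n k = hilbPoly r n k := by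
  have h : hilbS r n k = hilbertSeries (gradedPart (expIdeal r n (fun _ => k * r) k)) := by
    rw [← powerIdeal_eq_expIdeal hk]
    rfl
  ext d
  rw [h, hilbertSeries, PowerSeries.coeff_mk, Polynomial.coeff_coe]
  refine (hilbertBound_const hr n k).eq_coeff_of_values hr (rootLetter_injective hr) (fun b => some b.1)
    (pow_add_one_injective hr) (fun b j hj => ?_) (letterPoly_monic hr) (natDegree_letterPoly hr)
    (eval_letterPoly hr) (le_of_eq ?_) d
  · rw [Option.some_inj] at hj
    rw [rootLetter_pow hr, hj]
  · rw [natCard_hit_eq_hitCount (r := r) (fun b : Fin k × Fin r => some b.1), eval_one_hilbPoly]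
    · simp [mul_comm]
    · intro j
      let e : {b : Fin k × Fin r // some b.1 = some j} ≃ Fin r :=
        { toFun b := b.1.2
          invFun c := ⟨(j, c), rfl⟩
          left_inv b := Subtype.ext (Prod.ext (Option.some_inj.1 b.2).symm rfl)
          right_inv c := rfl }
      rw [Nat.card_congr e, Nat.card_fin]

theorem hilbR_eq {r n k : ℕ} (hr : 0 < r) (hk : k ≤ n) : hilbR r n k =
    ((∑ z ∈ Finset.range (n + 1), (n.choose z : Polynomial ℤ) * Polynomial.X ^ (k * r * z) *
      hilbPoly r (n - z) k : Polynomial ℤ) : PowerSeries ℤ) := by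
  set P := ∑ z ∈ Finset.range (n + 1), (n.choose z : Polynomial ℤ) *
    Polynomial.X ^ (k * r * z) * hilbPoly r (n - z) k with hPdef
  have hP : HilbertBound (expIdeal r n (fun _ => k * r + 1) k) P := by
    have h := hilbertBound_raised hr k (le_refl n)
    simpa only [Fin.is_lt, if_true, ← pow_mul] using h
  have h : hilbR r n k = hilbertSeries (gradedPart (expIdeal r n (fun _ => k * r + 1) k)) := by
    rw [← powerIdeal_eq_expIdeal hk]
    rfl
  ext d
  rw [h, hilbertSeries, PowerSeries.coeff_mk, Polynomial.coeff_coe]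
  -- The extra letter `0` belongs to no class; it adds a factor `X` to the vanishing polynomial,
  -- which accounts for the exponent `kr + 1`.
  let v : Option (Fin k × Fin r) → ℂ := fun b => b.elim 0 (rootLetter r k)
  have hv : Function.Injective v := by
    rintro (_ | a) (_ | b) h
    · rfl
    · exact absurd h.symm (rootLetter_ne_zero hr b)
    · exact absurd h (rootLetter_ne_zero hr a)
    · exact congrArg some (rootLetter_injective hr h)
  refine hP.eq_coeff_of_values hr hv (fun b => b.map Prod.fst) (pow_add_one_injective hr)
    (fun b j hj => ?_) (Q := Polynomial.X * letterPoly r k)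
    (Polynomial.monic_X.mul (letterPoly_monic hr)) ?_ (fun b => ?_) (le_of_eq ?_) d
  · obtain ⟨a, rfl, rfl⟩ := Option.map_eq_some_iff.1 hj
    exact rootLetter_pow hr a
  · rw [Polynomial.natDegree_X_mul (letterPoly_monic hr).ne_zero, natDegree_letterPoly hr]
  · rw [Polynomial.eval_mul, Polynomial.eval_X]
    rcases b with _ | b
    · exact zero_mul _
    · exact mul_eq_zero_of_right _ (eval_letterPoly hr b)
  · rw [natCard_hit_eq_hitCount (r := r), hPdef, Polynomial.eval_finsetSum]
    · simpa [mul_comm] using sum_choose_eval_one_hilbPoly r n k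
    · intro j
      let e : {b : Option (Fin k × Fin r) // b.map Prod.fst = some j} ≃ Fin r :=
        { toFun b := match b with
            | ⟨some a, _⟩ => a.2
          invFun c := ⟨some (j, c), rfl⟩
          left_inv b := by
            rcases b with ⟨_ | a, h⟩
            · exact absurd h (by simp)
            · exact Subtype.ext (congrArg some (Prod.ext (Option.some_inj.1 h).symm rfl))
          right_inv c := rfl }
      rw [Nat.card_congr e, Nat.card_fin]

end WreathCoinvariant

theorem mainTheorem5 (r n k : ℕ) (hr : 2 ≤ r) (hn : 1 ≤ n) (hk : k ≤ n) :
    (WreathCoinvariant.hilbR r n k =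
      ((∑ z ∈ Finset.range (n + 1),
        (n.choose z : Polynomial ℤ) * Polynomial.X ^ (k * r * z) *
          Polynomial.reverse
            (WreathCoinvariant.qInt (Polynomial.X : Polynomial ℤ) r ^ (n - z) *
              WreathCoinvariant.qFactorial (Polynomial.X ^ r : Polynomial ℤ) k *
              WreathCoinvariant.qStirling (Polynomial.X ^ r : Polynomial ℤ) (n - z) k) :
        Polynomial ℤ) : PowerSeries ℤ)) ∧
    (WreathCoinvariant.hilbR r n k =
      ((∑ z ∈ Finset.range (n + 1),
        (n.choose z : Polynomial ℤ) * Polynomial.X ^ (k * r * z) *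
          WreathCoinvariant.qInt (Polynomial.X : Polynomial ℤ) r ^ (n - z) *
            WreathCoinvariant.qFactorial (Polynomial.X ^ r : Polynomial ℤ) k *
            Polynomial.reverse
              (WreathCoinvariant.qStirling (Polynomial.X ^ r : Polynomial ℤ) (n - z) k) :
        Polynomial ℤ) : PowerSeries ℤ)) ∧
    (WreathCoinvariant.hilbS r n k =
      ((Polynomial.reverse
          (WreathCoinvariant.qInt (Polynomial.X : Polynomial ℤ) r ^ n *
            WreathCoinvariant.qFactorial (Polynomial.X ^ r : Polynomial ℤ) k *
            WreathCoinvariant.qStirling (Polynomial.X ^ r : Polynomial ℤ) n k) :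
        Polynomial ℤ) : PowerSeries ℤ)) ∧
    (WreathCoinvariant.hilbS r n k =
      ((WreathCoinvariant.qInt (Polynomial.X : Polynomial ℤ) r ^ n *
          WreathCoinvariant.qFactorial (Polynomial.X ^ r : Polynomial ℤ) k *
          Polynomial.reverse
            (WreathCoinvariant.qStirling (Polynomial.X ^ r : Polynomial ℤ) n k) :
        Polynomial ℤ) : PowerSeries ℤ)) := by
  have hr0 : 0 < r := by lia
  have hrev : ∀ m, WreathCoinvariant.qInt (Polynomial.X : Polynomial ℤ) r ^ m *
      WreathCoinvariant.qFactorial (Polynomial.X ^ r : Polynomial ℤ) k *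
      Polynomial.reverse (WreathCoinvariant.qStirling (Polynomial.X ^ r : Polynomial ℤ) m k) =
      WreathCoinvariant.hilbPoly r m k := fun m => by
    rw [WreathCoinvariant.reverse_qStirling hr0, WreathCoinvariant.hilbPoly]
  refine ⟨?_, ?_, ?_, ?_⟩
  · simp only [WreathCoinvariant.reverse_eq_hilbPoly hr0]
    exact WreathCoinvariant.hilbR_eq hr0 hk
  · rw [WreathCoinvariant.hilbR_eq hr0 hk]
    simp only [← hrev, mul_assoc]
  · rw [WreathCoinvariant.reverse_eq_hilbPoly hr0]
    exact WreathCoinvariant.hilbS_eq hr0 hk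
  · rw [hrev]
    exact WreathCoinvariant.hilbS_eq hr0 hk
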